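/- Let $G$ be a finite group. The power graph of $G$ has vertex set $G$, two distinct elements being adjacent if one is a power of the other; the enhanced power graph of $G$ has vertex set $G$, two distinct elements being adjacent if both are powers of some common element $c \in G$. The difference graph $\mathcal{D}(G)$ is obtained from the graph on $G$ whose edges are the edges of the enhanced power graph that are not edges of the power graph, by removing all isolated vertices. A graph is outerplanar if it can be drawn in the plane without edge crossings such that all its vertices lie on the boundary of the outer (unbounded) face. A star graph is a complete bipartite graph $K_{1,n}$, $n \ge 1$. Theorem. Let $G$ be a finite nilpotent group which is not a $p$-group for any prime $p$. Then $\mathcal{D}(G)$ is an outerplanar graph if and only if $G \cong \mathbb{Z}_2 \times P$ for some prime $p > 2$ and some $p$-group $P$ of exponent $p$. Moreover, in that case $\mathcal{D}(G)$ is a star graph. -/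

import Mathlib

universe u

open Set Topology

/-- The power graph of a group: distinct `x`, `y` are adjacent iff one is a power of the other. -/
def powerGraph (G : Type*) [Group G] : SimpleGraph G where
  Adj x y := x ≠ y ∧ (x ∈ Subgroup.zpowers y ∨ y ∈ Subgroup.zpowers x)
  symm := ⟨fun _ _ h => ⟨h.1.symm, h.2.symm⟩⟩
  loopless := ⟨fun _ h => h.1 rfl⟩

/-- The enhanced power graph of a group: distinct `x`, `y` are adjacent iff both are powers of
a common element. -/
def enhancedPowerGraph (G : Type*) [Group G] : SimpleGraph G where
  Adj x y := x ≠ y ∧ ∃ c : G, x ∈ Subgroup.zpowers c ∧ y ∈ Subgroup.zpowers c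
  symm := ⟨fun _ _ h => ⟨h.1.symm, h.2.imp fun _ hc => hc.symm⟩⟩
  loopless := ⟨fun _ h => h.1 rfl⟩

/-- The enhanced power graph minus (the edges of) the power graph, on all of `G`. -/
def fullDifferenceGraph (G : Type*) [Group G] : SimpleGraph G :=
  enhancedPowerGraph G \ powerGraph G

/-- The difference graph `D(G)`: the difference of the enhanced power graph and the power graph,
with all isolated vertices removed. -/
def differenceGraph (G : Type*) [Group G] : SimpleGraph (fullDifferenceGraph G).support :=
  (fullDifferenceGraph G).induce (fullDifferenceGraph G).support

/-- A star graph: a complete bipartite graph `K_{1,n}` with `n ≥ 1`. -/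
def IsStarGraph {V : Type*} (Γ : SimpleGraph V) : Prop :=
  ∃ n : ℕ, 1 ≤ n ∧ Nonempty (Γ ≃g completeBipartiteGraph (Fin 1) (Fin n))

/-- The Euclidean plane. -/
abbrev Plane : Type := EuclideanSpace ℝ (Fin 2)

/-- A drawing of a graph in the plane without edge crossings: vertices are distinct points, every
edge is a simple continuous arc joining its two end vertices and meeting no other vertex, and two
different edges meet only in common end vertices. -/
structure PlaneDrawing {V : Type*} (Γ : SimpleGraph V) where
  point : V → Plane
  point_injective : Function.Injective point
  arc : Γ.edgeSet → Set Plane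
  arc_isArc : ∀ (u v : V) (h : Γ.Adj u v), ∃ γ : unitInterval → Plane,
    Continuous γ ∧ Function.Injective γ ∧ γ 0 = point u ∧ γ 1 = point v ∧
      range γ = arc ⟨s(u, v), h⟩
  mem_of_point_mem_arc : ∀ (e : Γ.edgeSet) (v : V), point v ∈ arc e → v ∈ e.1
  no_crossing : ∀ e f : Γ.edgeSet, e ≠ f → ∀ p ∈ arc e ∩ arc f,
    ∃ v : V, v ∈ e.1 ∧ v ∈ f.1 ∧ p = point v

/-- The set of points of the plane used by a drawing. -/
def PlaneDrawing.carrier {V : Type*} {Γ : SimpleGraph V} (D : PlaneDrawing Γ) : Set Plane :=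
  range D.point ∪ ⋃ e : Γ.edgeSet, D.arc e

/-- `U` is an outer face of the drawing: an unbounded connected component of the complement.
(For a drawing of a finite graph there is exactly one.) -/
def PlaneDrawing.IsOuterFace {V : Type*} {Γ : SimpleGraph V} (D : PlaneDrawing Γ)
    (U : Set Plane) : Prop :=
  (∃ p ∈ D.carrierᶜ, U = connectedComponentIn D.carrierᶜ p) ∧ ¬ Bornology.IsBounded U

/-- A graph is outerplanar if it has a drawing in the plane without edge crossings in which every
vertex lies on (the boundary of) the outer face. -/
def IsOuterplanar {V : Type*} (Γ : SimpleGraph V) : Prop :=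
  ∃ (D : PlaneDrawing Γ) (U : Set Plane), D.IsOuterFace U ∧ ∀ v : V, D.point v ∈ frontier U

/-- `G ≅ ℤ₂ × P` for some `p`-group `P` whose exponent is the prime `p > 2`. -/
def IsZTwoProdExponentPrime (G : Type u) [Group G] : Prop :=
  ∃ p : ℕ, p.Prime ∧ 2 < p ∧ ∃ (P : Type u) (_ : Group P), IsPGroup p P ∧
    Monoid.exponent P = p ∧ Nonempty (G ≃* Multiplicative (ZMod 2) × P)

/-! Commuting nontrivial elements `x`, `y` of coprime orders are adjacent in the difference graph:
both are powers of `x * y`, neither is a power of the other. In a nilpotent group different Sylow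
subgroups commute elementwise, so coprime Sylow subgroups of orders at least 3 and 4 produce a
`K_{2,3}`, which no outerplanar graph contains. Hence of any two prime divisors the smaller is 2,
with Sylow subgroup of order 2, and `G ≅ ℤ₂ × Q` for a single odd prime `q`. If some `y` in `Q` had
`y ^ q ≠ 1`, then `z` (the involution) and `z * y ^ q` would share the neighbours `y`, `y⁻¹`, `y ^
2`. Conversely, when `Q` has exponent `q`, the only edges join `z` to the nontrivial elements of
`Q`: a star, which has a straight-line outerplanar drawing.

That `K_{2,3}` is not outerplanar follows from the nonplanarity of `K_{3,3}`, by joining a point of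
the outer face to the three middle vertices. The latter (`exists_paths_intersect`) is a parity
argument: for disjoint paths `γ`, `δ` the logarithm of `γ s - δ t` returns to its value around the
unit square, and the resulting integer relations are inconsistent modulo 2. -/

/-! ### Continuous logarithms of planar paths -/

/-- The change of a continuous logarithm of a nowhere vanishing path between the times `0` and
`1`. -/
noncomputable def logChange (f : ℝ → ℂ) : ℂ :=
  Classical.epsilon fun w => ∃ L : ℝ → ℂ, Continuous L ∧ (∀ t, Complex.exp (L t) = f t) ∧
    w = L 1 - L 0

theorem exists_continuous_log {X : Type*} [TopologicalSpace X] [SimplyConnectedSpace X]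
    [LocallyPathConnectedSpace X] {f : X → ℂ} (hf : Continuous f) (h0 : ∀ x, f x ≠ 0) :
    ∃ L : X → ℂ, Continuous L ∧ ∀ x, Complex.exp (L x) = f x := by
  have : Nonempty X := inferInstance
  obtain ⟨x₀⟩ := this
  obtain ⟨F, ⟨-, hF⟩, -⟩ := Complex.isCoveringMapOn_exp.existsUnique_continuousMap_lifts
    ⟨f, hf⟩ (a₀ := x₀) (Complex.exp_log (h0 x₀)) (fun x => h0 x)
  exact ⟨F, F.continuous, fun x => congrFun hF x⟩

/-- The difference of two logarithms is a continuous function with values in the discrete set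
`2πiℤ`, hence constant on the line. This makes `logChange` independent of the chosen logarithm. -/
theorem continuous_log_sub_eq {L M : ℝ → ℂ} (hL : Continuous L) (hM : Continuous M)
    (h : ∀ t, Complex.exp (L t) = Complex.exp (M t)) (s t : ℝ) : L s - L t = M s - M t := by
  have key : ∀ s, ∃ n : ℤ, L s - M s = n * (2 * Real.pi * Complex.I) := by
    intro s
    obtain ⟨n, hn⟩ := Complex.exp_eq_exp_iff_exists_int.1 (h s)
    exact ⟨n, by rw [hn]; ring⟩
  choose n hn using key
  have hpi : (2 * Real.pi * Complex.I) ≠ 0 := Complex.two_pi_I_ne_zero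
  have hc : Continuous fun s => (n s : ℂ) := by
    have : (fun s => (n s : ℂ)) = fun s => (L s - M s) / (2 * Real.pi * Complex.I) := by
      funext s
      rw [hn, mul_div_cancel_right₀ _ hpi]
    rw [this]
    fun_prop
  have hc' : Continuous n := by
    have hr : Continuous fun s => ((n s : ℤ) : ℝ) := by
      simpa [Function.comp_def] using Complex.continuous_re.comp hc
    exact Int.isClosedEmbedding_coe_real.isInducing.continuous_iff.2 hr
  have hconst : n s = n t := PreconnectedSpace.constant inferInstance hc'
  have h1 := hn s
  have h2 := hn t
  rw [hconst] at h1
  linear_combination h1 - h2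

theorem logChange_eq {f L : ℝ → ℂ} (hL : Continuous L) (h : ∀ t, Complex.exp (L t) = f t) :
    logChange f = L 1 - L 0 := by
  have := Classical.epsilon_spec (p := fun w => ∃ L : ℝ → ℂ, Continuous L ∧
    (∀ t, Complex.exp (L t) = f t) ∧ w = L 1 - L 0) ⟨_, L, hL, h, rfl⟩
  obtain ⟨M, hM, hM', he⟩ := this
  rw [logChange, he]
  exact continuous_log_sub_eq hM hL (fun t => by rw [h, hM']) 1 0

theorem exp_logChange {f : ℝ → ℂ} (hf : Continuous f) (h0 : ∀ x, f x ≠ 0) :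
    Complex.exp (logChange f) = f 1 / f 0 := by
  obtain ⟨L, hL, h⟩ := exists_continuous_log hf h0
  rw [logChange_eq hL h, Complex.exp_sub, h, h]

theorem logChange_neg {f : ℝ → ℂ} (hf : Continuous f) (h0 : ∀ x, f x ≠ 0) :
    logChange (fun t => -f t) = logChange f := by
  obtain ⟨L, hL, h⟩ := exists_continuous_log hf h0
  have hM : Continuous fun t => L t + Real.pi * Complex.I := by fun_prop
  rw [logChange_eq hL h, logChange_eq hM (f := fun t => -f t)]
  · ring
  · intro t
    rw [Complex.exp_add, h, Complex.exp_pi_mul_I]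
    ring

/-- The total change of the argument of `γ s - δ t` around the unit square vanishes. -/
theorem logChange_square {γ δ : ℝ → ℂ} (hγ : Continuous γ) (hδ : Continuous δ)
    (h : ∀ s t, γ s ≠ δ t) :
    logChange (fun s => γ s - δ 1) + logChange (fun t => δ t - γ 0) =
      logChange (fun t => δ t - γ 1) + logChange (fun s => γ s - δ 0) := by
  obtain ⟨L, hL, hexp⟩ := exists_continuous_log (X := ℝ × ℝ) (f := fun x => γ x.1 - δ x.2)
    (by fun_prop) (fun x => sub_ne_zero.2 (h _ _))
  have e : ∀ t, logChange (fun s => γ s - δ t) = L (1, t) - L (0, t) := fun t =>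
    logChange_eq (L := fun s => L (s, t)) (by fun_prop) (fun s => hexp (s, t))
  have e' : ∀ s, logChange (fun t => δ t - γ s) = L (s, 1) - L (s, 0) := by
    intro s
    rw [← logChange_eq (f := fun t => γ s - δ t) (L := fun t => L (s, t)) (by fun_prop)
      (fun t => hexp (s, t)), ← logChange_neg (by fun_prop) (fun t => sub_ne_zero.2 (h s t))]
    simp
  rw [e, e, e', e']
  ring

/-- A nonzero complex number written as a quotient: logarithms agree up to a period. -/
theorem exists_int_of_exp_eq_div {w a b : ℂ} (ha : a ≠ 0) (hb : b ≠ 0)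
    (h : Complex.exp w = a / b) :
    ∃ n : ℤ, w = Complex.log a - Complex.log b + n * (2 * Real.pi * Complex.I) := by
  apply Complex.exp_eq_exp_iff_exists_int.1
  rw [h, Complex.exp_sub, Complex.exp_log ha, Complex.exp_log hb]

theorem exists_int_log_neg {a : ℂ} (ha : a ≠ 0) :
    ∃ n : ℤ, Complex.log (-a) = Complex.log a + Real.pi * Complex.I +
      n * (2 * Real.pi * Complex.I) := by
  apply Complex.exp_eq_exp_iff_exists_int.1
  rw [Complex.exp_add, Complex.exp_log ha, Complex.exp_log (neg_ne_zero.2 ha),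
    Complex.exp_pi_mul_I]
  ring

/-! ### Nonplanarity of `K_{3,3}` -/

/-- The complete bipartite graph `K_{3,3}` cannot be drawn in the plane so that edges without a
common end vertex are disjoint. -/
theorem exists_paths_intersect (P Q : Fin 3 → ℂ) (γ : Fin 3 → Fin 3 → ℝ → ℂ)
    (hγ : ∀ x i, Continuous (γ x i)) (h0 : ∀ x i, γ x i 0 = P x) (h1 : ∀ x i, γ x i 1 = Q i) :
    ∃ x y i j, x ≠ y ∧ i ≠ j ∧ ∃ s t, γ x i s = γ y j t := by
  by_contra! hd
  have hother : ∀ i : Fin 3, ∃ j, i ≠ j := by decide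
  have hP : ∀ x y, x ≠ y → ∀ j t, γ y j t ≠ P x := by
    intro x y hxy j t
    obtain ⟨i, hi⟩ := hother j
    rw [← h0 x i]
    exact (hd x y i j hxy hi.symm 0 t).symm
  have hQ : ∀ i j, i ≠ j → ∀ y t, γ y j t ≠ Q i := by
    intro i j hij y t
    obtain ⟨x, hx⟩ := hother y
    rw [← h1 x i]
    exact (hd x y i j hx.symm hij 1 t).symm
  have hPP : ∀ x y, x ≠ y → P y - P x ≠ 0 := fun x y hxy =>
    sub_ne_zero.2 (by rw [← h0 y 0]; exact hP x y hxy 0 0)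
  have hQQ : ∀ i j, i ≠ j → Q j - Q i ≠ 0 := fun i j hij =>
    sub_ne_zero.2 (by rw [← h1 0 j]; exact hQ i j hij 0 1)
  have hQP : ∀ j x, Q j - P x ≠ 0 := by
    intro j x
    obtain ⟨y, hy⟩ := hother x
    exact sub_ne_zero.2 (by rw [← h1 y j]; exact hP x y hy j 1)
  have e1 : ∀ x y j, ∃ n : ℤ, x ≠ y → logChange (fun t => γ y j t - P x) =
      Complex.log (Q j - P x) - Complex.log (P y - P x) + n * (2 * Real.pi * Complex.I) := by
    intro x y j
    by_cases hxy : x = y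
    · exact ⟨0, fun h => absurd hxy h⟩
    have hc := hγ y j
    obtain ⟨n, hn⟩ := exists_int_of_exp_eq_div (w := logChange (fun t => γ y j t - P x))
      (hQP j x) (hPP x y hxy)
      (by rw [exp_logChange (by fun_prop) (fun t => sub_ne_zero.2 (hP x y hxy j t)), h0, h1])
    exact ⟨n, fun _ => hn⟩
  -- The start value `P x - Q j` is rewritten through `Q j - P x`, at the cost of `πi`, so that the
  -- mixed logarithms cancel in `rel`.
  have e2 : ∀ j i x, ∃ n : ℤ, j ≠ i → logChange (fun t => γ x i t - Q j) =
      Complex.log (Q i - Q j) - Complex.log (Q j - P x) - Real.pi * Complex.I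
        + n * (2 * Real.pi * Complex.I) := by
    intro j i x
    by_cases hij : j = i
    · exact ⟨0, fun h => absurd hij h⟩
    have hc := hγ x i
    obtain ⟨n, hn⟩ := exists_int_of_exp_eq_div (w := logChange (fun t => γ x i t - Q j))
      (hQQ j i hij) (neg_ne_zero.2 (hQP j x))
      (by rw [exp_logChange (by fun_prop) (fun t => sub_ne_zero.2 (hQ j i hij x t)), h0, h1,
            neg_sub])
    obtain ⟨m, hm⟩ := exists_int_log_neg (hQP j x)
    refine ⟨n - m, fun _ => ?_⟩
    rw [hn, hm]
    push_cast
    ring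
  choose n1 hn1 using e1
  choose n2 hn2 using e2
  have eP : ∀ x y, ∃ n : ℤ, x ≠ y → Complex.log (P x - P y) = Complex.log (P y - P x) +
      Real.pi * Complex.I + n * (2 * Real.pi * Complex.I) := by
    intro x y
    by_cases hxy : x = y
    · exact ⟨0, fun h => absurd hxy h⟩
    obtain ⟨m, hm⟩ := exists_int_log_neg (hPP x y hxy)
    exact ⟨m, fun _ => by rw [← hm, neg_sub]⟩
  have eQ : ∀ x y, ∃ n : ℤ, x ≠ y → Complex.log (Q x - Q y) = Complex.log (Q y - Q x) +
      Real.pi * Complex.I + n * (2 * Real.pi * Complex.I) := by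
    intro x y
    by_cases hxy : x = y
    · exact ⟨0, fun h => absurd hxy h⟩
    obtain ⟨m, hm⟩ := exists_int_log_neg (hQQ x y hxy)
    exact ⟨m, fun _ => by rw [← hm, neg_sub]⟩
  choose a ha using eP
  choose b hb using eQ
  -- In the square identity all logarithms cancel; only the integer multiples of `2πi` survive.
  have rel : ∀ x y i j, x ≠ y → i ≠ j →
      n2 j i x + n1 x y j + a x y = n2 i j y + n1 y x i + b j i := by
    intro x y i j hxy hij
    have hsq := logChange_square (hγ x i) (hγ y j) (hd x y i j hxy hij)
    rw [h0, h0, h1, h1, hn1 x y j hxy, hn1 y x i hxy.symm, hn2 i j y hij, hn2 j i x hij.symm,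
      ha x y hxy, hb j i hij.symm] at hsq
    have : ((n2 j i x + n1 x y j + a x y : ℤ) : ℂ) * (2 * Real.pi * Complex.I) =
        ((n2 i j y + n1 y x i + b j i : ℤ) : ℂ) * (2 * Real.pi * Complex.I) := by
      push_cast
      linear_combination hsq
    exact_mod_cast mul_right_cancel₀ Complex.two_pi_I_ne_zero this
  -- Changing the sign twice adds `2πi` to the logarithm, which the two corrections must undo.
  have hbb : ∀ i j, i ≠ j → b i j + b j i = -1 := by
    intro i j hij
    have h2 := hb i j hij
    rw [hb j i hij.symm] at h2
    have : ((b i j + b j i : ℤ) : ℂ) * (2 * Real.pi * Complex.I) =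
        ((-1 : ℤ) : ℂ) * (2 * Real.pi * Complex.I) := by
      push_cast
      linear_combination -h2
    exact_mod_cast mul_right_cancel₀ Complex.two_pi_I_ne_zero this
  -- Adding the relations for `(i, j)` and `(j, i)` makes the unknown `a` even and replaces the
  -- unknowns `b` by `-1`.
  have pair : ∀ x y, x ≠ y → ∀ i j, i ≠ j → n2 j i x + n1 x y j + n2 i j x + n1 x y i +
      2 * a x y = n2 i j y + n1 y x i + n2 j i y + n1 y x j - 1 := by
    intro x y hxy i j hij
    linarith [rel x y i j hxy hij, rel x y j i hxy hij.symm, hbb i j hij]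
  have p01 := pair 0 1 (by decide)
  have p02 := pair 0 2 (by decide)
  have p12 := pair 1 2 (by decide)
  have d01 : (0 : Fin 3) ≠ 1 := by decide
  have d02 : (0 : Fin 3) ≠ 2 := by decide
  have d12 : (1 : Fin 3) ≠ 2 := by decide
  have q1 := p01 0 1 d01
  have q2 := p01 0 2 d02
  have q3 := p01 1 2 d12
  have q4 := p02 0 1 d01
  have q5 := p02 0 2 d02
  have q6 := p02 1 2 d12
  have q7 := p12 0 1 d01
  have q8 := p12 0 2 d02
  have q9 := p12 1 2 d12
  clear p01 p02 p12 pair rel hn1 hn2 ha hb hbb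
  -- Let `T x` be the sum of all `n2 i j x` with `i ≠ j`. For fixed `x ≠ y`, summing `pair` over the
  -- three pairs `i`, `j` shows that `T x + T y` is odd. This cannot hold for all three pairs among
  -- three integers.
  omega

/-! ### Drawings, faces and the exclusion of `K_{2,3}` -/

namespace PlaneDrawing

variable {V : Type*} {Γ : SimpleGraph V} (D : PlaneDrawing Γ)

theorem exists_path {u v : V} (h : Γ.Adj u v) : ∃ γ : ℝ → Plane, Continuous γ ∧
    γ 0 = D.point u ∧ γ 1 = D.point v ∧ ∀ t, γ t ∈ D.arc ⟨s(u, v), h⟩ := by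
  obtain ⟨γ, hc, -, h0, h1, hr⟩ := D.arc_isArc u v h
  -- The path is constant outside `[0, 1]`, so it stays on the arc for every real time.
  refine ⟨fun t => γ (projIcc 0 1 zero_le_one t), hc.comp continuous_projIcc, ?_, ?_, ?_⟩
  · simpa using h0
  · simpa using h1
  · intro t
    rw [← hr]
    exact mem_range_self _

theorem isClosed_arc (e : Γ.edgeSet) : IsClosed (D.arc e) := by
  obtain ⟨e, he⟩ := e
  induction e with
  | h u v =>
    obtain ⟨γ, hc, -, -, -, hr⟩ := D.arc_isArc u v he
    rw [← hr]
    exact (isCompact_range hc).isClosed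

theorem isClosed_carrier [Finite V] : IsClosed D.carrier :=
  (finite_range D.point).isClosed.union (isClosed_iUnion_of_finite D.isClosed_arc)

/-- Around every vertex there is a disc missing all edges that do not end in it. -/
theorem exists_ball_disjoint_arc [Finite V] (v : V) : ∃ r > 0, ∀ e : Γ.edgeSet, v ∉ e.1 →
    Disjoint (Metric.ball (D.point v) r) (D.arc e) := by
  have hcl : IsClosed (⋃ e : {e : Γ.edgeSet // v ∉ e.1}, D.arc e.1) :=
    isClosed_iUnion_of_finite fun e => D.isClosed_arc e.1
  have hmem : D.point v ∈ (⋃ e : {e : Γ.edgeSet // v ∉ e.1}, D.arc e.1)ᶜ := by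
    simp only [mem_compl_iff, mem_iUnion, not_exists]
    exact fun e he => e.2 (D.mem_of_point_mem_arc e.1 v he)
  obtain ⟨r, hr, hsub⟩ := Metric.isOpen_iff.1 hcl.isOpen_compl _ hmem
  refine ⟨r, hr, fun e he => Set.disjoint_left.2 fun x hx hxe => hsub hx ?_⟩
  exact mem_iUnion.2 ⟨⟨e, he⟩, hxe⟩

/-- A point of a face is joined to a vertex on its frontier by a path that meets only edges ending
in that vertex. -/
theorem exists_path_of_mem_closure [Finite V] {U : Set Plane} (hU : IsPathConnected U)
    (hUD : U ⊆ D.carrierᶜ) {p : Plane} (hp : p ∈ U) {v : V} (hv : D.point v ∈ closure U) :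
    ∃ γ : ℝ → Plane, Continuous γ ∧ γ 0 = p ∧ γ 1 = D.point v ∧
      ∀ (e : Γ.edgeSet), v ∉ e.1 → ∀ t, γ t ∉ D.arc e := by
  obtain ⟨r, hr, hd⟩ := D.exists_ball_disjoint_arc v
  obtain ⟨q, hq, hqr⟩ := Metric.mem_closure_iff.1 hv r hr
  have hqb : q ∈ Metric.ball (D.point v) r := by rwa [Metric.mem_ball, dist_comm]
  have hb : IsPathConnected (Metric.ball (D.point v) r) :=
    (convex_ball _ _).isPathConnected ⟨_, Metric.mem_ball_self hr⟩
  have h1 : JoinedIn (U ∪ Metric.ball (D.point v) r) p q :=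
    (hU.joinedIn p hp q hq).mono subset_union_left
  have h2 : JoinedIn (U ∪ Metric.ball (D.point v) r) q (D.point v) :=
    (hb.joinedIn q hqb _ (Metric.mem_ball_self hr)).mono subset_union_right
  have h3 := h1.trans h2
  refine ⟨h3.somePath.extend, h3.somePath.continuous_extend, h3.somePath.extend_zero,
    h3.somePath.extend_one, fun e he t hte => ?_⟩
  have hmem : h3.somePath.extend t ∈ U ∪ Metric.ball (D.point v) r :=
    h3.somePath_mem (projIcc 0 1 zero_le_one t)
  rcases hmem with h | h
  · exact hUD h (Or.inr (mem_iUnion.2 ⟨e, hte⟩))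
  · exact Set.disjoint_left.1 (hd e he) h hte

/-- The carrier of a finite graph is closed, so the face is open, and connected open subsets of the
plane are path connected. -/
theorem IsOuterFace.isPathConnected [Finite V] {D : PlaneDrawing Γ} {U : Set Plane}
    (h : D.IsOuterFace U) : IsPathConnected U := by
  obtain ⟨⟨p, hp, rfl⟩, -⟩ := h
  have ho : IsOpen (connectedComponentIn D.carrierᶜ p) :=
    D.isClosed_carrier.isOpen_compl.connectedComponentIn
  exact ho.isConnected_iff_isPathConnected.1 (isConnected_connectedComponentIn_iff.2 hp)

end PlaneDrawing

/-- A graph containing `K_{2,3}` is not outerplanar. -/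
theorem not_isOuterplanar_of_adj {V : Type*} [Finite V] {Γ : SimpleGraph V} {a b : V}
    {m : Fin 3 → V} (hab : a ≠ b) (hm : Function.Injective m) (ha : ∀ i, Γ.Adj a (m i))
    (hb : ∀ i, Γ.Adj b (m i)) : ¬ IsOuterplanar Γ := by
  rintro ⟨D, U, hU, hfr⟩
  have hpc := hU.isPathConnected
  have hUD : U ⊆ D.carrierᶜ := by
    obtain ⟨⟨p, -, rfl⟩, -⟩ := hU
    exact connectedComponentIn_subset _ _
  obtain ⟨p, hp⟩ := hpc.nonempty
  choose α hαc hα0 hα1 hα using fun i => D.exists_path (ha i)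
  choose β hβc hβ0 hβ1 hβ using fun i => D.exists_path (hb i)
  -- The point `p` of the face acts as the third vertex on the side of `a` and `b`. The paths `δ i`
  -- may cross one another, and `δ i` may meet edges ending in `m i`: only paths without a common
  -- end are compared.
  choose δ hδc hδ0 hδ1 hδ using fun i =>
    D.exists_path_of_mem_closure hpc hUD hp (frontier_subset_closure (hfr (m i)))
  have hαβ : ∀ i j, i ≠ j → ∀ s t, α i s ≠ β j t := by
    intro i j hij s t he
    have hne : m i ≠ m j := hm.ne hij
    have h1 := (ha i).ne
    have h2 := (hb j).ne
    have h3 := (ha j).ne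
    have h4 := (hb i).ne
    have hno : ∀ v, v ∈ s(a, m i) → v ∈ s(b, m j) → False := by
      intro v hv hv'
      simp only [Sym2.mem_iff] at hv hv'
      rcases hv with rfl | rfl <;> rcases hv' with h | h <;> simp_all
    have hef : (⟨s(a, m i), ha i⟩ : Γ.edgeSet) ≠ ⟨s(b, m j), hb j⟩ := by
      intro h
      have h' : s(a, m i) = s(b, m j) := congrArg Subtype.val h
      exact hno a (by simp) (h' ▸ by simp)
    obtain ⟨v, hv, hv', -⟩ := D.no_crossing _ _ hef (α i s) ⟨hα i s, he ▸ hβ j t⟩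
    exact hno v hv hv'
  have hαδ : ∀ i j, i ≠ j → ∀ s t, α i s ≠ δ j t := by
    intro i j hij s t he
    refine hδ j ⟨s(a, m i), ha i⟩ ?_ t (he ▸ hα i s)
    simp only [Sym2.mem_iff, not_or]
    exact ⟨(ha j).ne', hm.ne hij.symm⟩
  have hβδ : ∀ i j, i ≠ j → ∀ s t, β i s ≠ δ j t := by
    intro i j hij s t he
    refine hδ j ⟨s(b, m i), hb i⟩ ?_ t (he ▸ hβ i s)
    simp only [Sym2.mem_iff, not_or]
    exact ⟨(hb j).ne', hm.ne hij.symm⟩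
  let φ := Complex.orthonormalBasisOneI.repr.symm
  obtain ⟨x, y, i, j, hxy, hij, s, t, hst⟩ := exists_paths_intersect
    ![φ (D.point a), φ (D.point b), φ p] (fun i => φ (D.point (m i)))
    (fun x i t => φ ((![α, β, δ] : Fin 3 → Fin 3 → ℝ → Plane) x i t))
    (by
      intro x i
      refine φ.continuous.comp ?_
      fin_cases x
      exacts [hαc i, hβc i, hδc i])
    (by
      intro x i
      fin_cases x
      exacts [congrArg φ (hα0 i), congrArg φ (hβ0 i), congrArg φ (hδ0 i)])
    (by
      intro x i
      fin_cases x
      exacts [congrArg φ (hα1 i), congrArg φ (hβ1 i), congrArg φ (hδ1 i)])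
  have hst := φ.injective hst
  fin_cases x <;> fin_cases y
  exacts [hxy rfl, hαβ i j hij s t hst, hαδ i j hij s t hst, hαβ j i hij.symm t s hst.symm,
    hxy rfl, hβδ i j hij s t hst, hαδ j i hij.symm t s hst.symm, hβδ j i hij.symm t s hst.symm,
    hxy rfl]

/-! ### Outerplanar drawing of a star -/

/-- The vertices of a drawing of `K_{1,n}`: the centre at the origin, the leaves on a vertical
line. -/
noncomputable def starPoint {n : ℕ} : Fin 1 ⊕ Fin n → Plane
  | .inl _ => 0
  | .inr k => !₂[1, (k : ℝ)]

theorem starPoint_injective {n : ℕ} : Function.Injective (starPoint (n := n)) := by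
  rintro (i | k) (j | l) h
  · rw [Subsingleton.elim i j]
  · have := congrArg (fun x : Plane => x 0) h
    simp [starPoint] at this
  · have := congrArg (fun x : Plane => x 0) h
    simp [starPoint] at this
  · have := congrArg (fun x : Plane => x 1) h
    simp only [starPoint, PiLp.toLp_apply, Matrix.cons_val_one, Matrix.cons_val_fin_one,
      Nat.cast_inj] at this
    rw [Fin.ext this]

section

variable {V : Type*} {Γ : SimpleGraph V} {n : ℕ} (ψ : Γ ≃g completeBipartiteGraph (Fin 1) (Fin n))

theorem exists_eq_center_leaf (e : Γ.edgeSet) :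
    ∃ k : Fin n, e.1 = s(ψ.symm (.inl 0), ψ.symm (.inr k)) := by
  obtain ⟨e, he⟩ := e
  induction e with
  | h u v =>
    have h : (completeBipartiteGraph (Fin 1) (Fin n)).Adj (ψ u) (ψ v) := ψ.map_adj_iff.2 he
    obtain ⟨u, rfl⟩ := ψ.symm.surjective u
    obtain ⟨v, rfl⟩ := ψ.symm.surjective v
    rw [RelIso.apply_symm_apply, RelIso.apply_symm_apply] at h
    rcases u with i | k <;> rcases v with j | l
    · simp at h
    · obtain rfl := Subsingleton.elim i 0
      exact ⟨l, rfl⟩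
    · obtain rfl := Subsingleton.elim j 0
      exact ⟨k, Sym2.eq_swap⟩
    · simp at h

/-- The straight segment joining the end vertices of an edge. -/
noncomputable def starArc (e : Γ.edgeSet) : Set Plane :=
  convexHull ℝ ((fun v => starPoint (ψ v)) '' {v | v ∈ e.1})

theorem starArc_mk {u v : V} (h : Γ.Adj u v) :
    starArc ψ ⟨s(u, v), h⟩ = segment ℝ (starPoint (ψ u)) (starPoint (ψ v)) := by
  have : {w | w ∈ s(u, v)} = {u, v} := by
    ext w
    simp
  rw [starArc, this, image_pair, convexHull_pair]

theorem mem_starArc {e : Γ.edgeSet} {k : Fin n}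
    (he : e.1 = s(ψ.symm (.inl 0), ψ.symm (.inr k))) {x : Plane} :
    x ∈ starArc ψ e ↔ 0 ≤ x 0 ∧ x 0 ≤ 1 ∧ x 1 = x 0 * k := by
  have hset : {w | w ∈ e.1} = {ψ.symm (.inl 0), ψ.symm (.inr k)} := by
    ext w
    simp [he]
  rw [starArc, hset, image_pair, convexHull_pair, RelIso.apply_symm_apply,
    RelIso.apply_symm_apply, segment_eq_image']
  constructor
  · rintro ⟨t, ⟨h0, h1⟩, rfl⟩
    simp [starPoint, h0, h1]
  · rintro ⟨h0, h1, h⟩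
    refine ⟨x 0, ⟨h0, h1⟩, ?_⟩
    ext i
    fin_cases i <;> simp [starPoint, h]

theorem mem_of_starPoint_mem_starArc (e : Γ.edgeSet) (v : V)
    (hv : starPoint (ψ v) ∈ starArc ψ e) : v ∈ e.1 := by
  obtain ⟨k, hk⟩ := exists_eq_center_leaf ψ e
  rw [mem_starArc ψ hk] at hv
  rw [hk, Sym2.mem_iff]
  obtain ⟨v, rfl⟩ := ψ.symm.surjective v
  rw [RelIso.apply_symm_apply] at hv
  rcases v with i | l
  · exact Or.inl (by rw [Subsingleton.elim i 0])
  · obtain ⟨-, -, h⟩ := hv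
    simp only [starPoint, PiLp.toLp_apply, Matrix.cons_val_one, Matrix.cons_val_zero,
      Matrix.cons_val_fin_one, one_mul, Nat.cast_inj] at h
    exact Or.inr (by rw [Fin.ext h])

/-- The straight-line drawing of a star. -/
noncomputable def starDrawing : PlaneDrawing Γ where
  point v := starPoint (ψ v)
  point_injective := starPoint_injective.comp ψ.injective
  arc := starArc ψ
  arc_isArc u v h := by
    have hne : starPoint (ψ u) ≠ starPoint (ψ v) :=
      (starPoint_injective.comp ψ.injective).ne h.ne
    refine ⟨fun t => AffineMap.lineMap (starPoint (ψ u)) (starPoint (ψ v)) (t : ℝ), ?_, ?_, ?_,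
      ?_, ?_⟩
    · exact AffineMap.lineMap_continuous.comp continuous_subtype_val
    · exact (AffineMap.lineMap_injective ℝ hne).comp Subtype.val_injective
    · simp
    · simp
    · rw [starArc_mk, segment_eq_image_lineMap]
      ext x
      simp
  mem_of_point_mem_arc := mem_of_starPoint_mem_starArc ψ
  no_crossing e f hef p hp := by
    obtain ⟨k, hk⟩ := exists_eq_center_leaf ψ e
    obtain ⟨l, hl⟩ := exists_eq_center_leaf ψ f
    have hkl : k ≠ l := by
      rintro rfl
      exact hef (Subtype.ext (hk.trans hl.symm))
    have h1 := ((mem_starArc ψ hk).1 hp.1).2.2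
    have h2 := ((mem_starArc ψ hl).1 hp.2).2.2
    have hx : p 0 = 0 := by
      by_contra hx
      have := mul_left_cancel₀ hx (h1.symm.trans h2)
      exact hkl (Fin.ext (Nat.cast_injective this))
    refine ⟨ψ.symm (.inl 0), by simp [hk], by simp [hl], ?_⟩
    rw [RelIso.apply_symm_apply]
    ext i
    fin_cases i
    · simp [starPoint, hx]
    · simp [starPoint, h1, hx]

/-- Enclosing the drawing in a half-strip gives an explicit connected unbounded region outside it,
so the outer face need not be computed. -/
theorem starDrawing_carrier_subset :
    (starDrawing ψ).carrier ⊆ {x | 0 ≤ x 0 ∧ x 0 ≤ 1 ∧ 0 ≤ x 1} := by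
  rintro x (⟨v, rfl⟩ | hx)
  · change 0 ≤ starPoint (ψ v) 0 ∧ starPoint (ψ v) 0 ≤ 1 ∧ 0 ≤ starPoint (ψ v) 1
    rcases ψ v with i | k <;> simp [starPoint]
  · obtain ⟨e, he⟩ := mem_iUnion.1 hx
    obtain ⟨k, hk⟩ := exists_eq_center_leaf ψ e
    obtain ⟨h0, h1, h⟩ := (mem_starArc ψ hk).1 he
    exact ⟨h0, h1, by rw [h]; positivity⟩

end

/-- The complement of a vertical half-strip. -/
theorem isPreconnected_compl_halfStrip :
    IsPreconnected {x : Plane | x 0 < 0 ∨ 1 < x 0 ∨ x 1 < 0} := by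
  have c0 : Convex ℝ {x : Plane | x 0 < 0} :=
    (convex_Iio (0 : ℝ)).linear_preimage (EuclideanSpace.proj (𝕜 := ℝ) (0 : Fin 2)).toLinearMap
  have c1 : Convex ℝ {x : Plane | 1 < x 0} :=
    (convex_Ioi (1 : ℝ)).linear_preimage (EuclideanSpace.proj (𝕜 := ℝ) (0 : Fin 2)).toLinearMap
  have c2 : Convex ℝ {x : Plane | x 1 < 0} :=
    (convex_Iio (0 : ℝ)).linear_preimage (EuclideanSpace.proj (𝕜 := ℝ) (1 : Fin 2)).toLinearMap
  -- The three half-planes are convex; consecutive ones are glued at a common point.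
  have h1 : IsPreconnected ({x : Plane | 1 < x 0} ∪ {x : Plane | x 1 < 0}) :=
    IsPreconnected.union (!₂[2, -1] : Plane) (by simp) (by simp) c1.isPreconnected
      c2.isPreconnected
  exact IsPreconnected.union (!₂[-1, -1] : Plane) (s := {x | x 0 < 0})
    (t := {x | 1 < x 0 ∨ x 1 < 0}) (by simp) (Or.inr (by simp)) c0.isPreconnected h1

theorem not_isBounded_of_halfPlane_subset {U : Set Plane} (h : {x : Plane | x 1 < 0} ⊆ U) :
    ¬ Bornology.IsBounded U := by
  intro hb
  obtain ⟨R, hR⟩ := (hb.subset h).exists_norm_le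
  have hmem : (!₂[0, -(|R| + 1)] : Plane) ∈ {x : Plane | x 1 < 0} := by
    simp only [mem_ofPred_eq, Matrix.cons_val_one, Matrix.cons_val_fin_one]
    linarith [abs_nonneg R]
  have h1 := hR _ hmem
  have h2 := PiLp.norm_apply_le (!₂[0, -(|R| + 1)] : Plane) 1
  simp only [Matrix.cons_val_one, Matrix.cons_val_fin_one, norm_neg,
    Real.norm_eq_abs] at h2
  rw [abs_of_nonneg (by positivity)] at h2
  linarith [le_abs_self R]

/-- The centre lies on the left side of the half-strip and the leaves on its right side, so a
horizontal shift by `ε / 2` leaves the strip. -/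
theorem starPoint_mem_closure {n : ℕ} (w : Fin 1 ⊕ Fin n) :
    starPoint w ∈ closure {x : Plane | x 0 < 0 ∨ 1 < x 0 ∨ x 1 < 0} := by
  rw [Metric.mem_closure_iff]
  intro ε hε
  rcases w with i | k
  · refine ⟨!₂[-(ε / 2), 0], Or.inl (by simpa using hε), ?_⟩
    rw [EuclideanSpace.dist_eq]
    simp only [starPoint, Fin.sum_univ_two]
    simp [Real.sqrt_sq_eq_abs]
    rw [abs_of_pos hε, abs_of_pos (half_pos hε)]
    exact half_lt_self hε
  · refine ⟨!₂[1 + ε / 2, (k : ℝ)], Or.inr (Or.inl (by simpa using hε)), ?_⟩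
    rw [EuclideanSpace.dist_eq]
    simp only [starPoint, Fin.sum_univ_two]
    simp [Real.sqrt_sq_eq_abs]
    rw [abs_of_pos hε, abs_of_pos (half_pos hε)]
    exact half_lt_self hε

/-- Stars are outerplanar. -/
theorem IsStarGraph.isOuterplanar {V : Type*} {Γ : SimpleGraph V} (h : IsStarGraph Γ) :
    IsOuterplanar Γ := by
  obtain ⟨n, -, ⟨ψ⟩⟩ := h
  set W : Set Plane := {x : Plane | x 0 < 0 ∨ 1 < x 0 ∨ x 1 < 0} with hW
  have hWD : W ⊆ (starDrawing ψ).carrierᶜ := by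
    intro x hx hc
    obtain ⟨h0, h1, h2⟩ := starDrawing_carrier_subset ψ hc
    rcases hx with hx | hx | hx <;> linarith
  have hp : (!₂[-1, 0] : Plane) ∈ W := Or.inl (by simp)
  have hWU : W ⊆ connectedComponentIn (starDrawing ψ).carrierᶜ !₂[-1, 0] :=
    isPreconnected_compl_halfStrip.subset_connectedComponentIn hp hWD
  refine ⟨starDrawing ψ, _, ⟨⟨_, hWD hp, rfl⟩, not_isBounded_of_halfPlane_subset
    fun x hx => hWU (Or.inr (Or.inr hx))⟩, fun v => ⟨closure_mono hWU (starPoint_mem_closure _),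
    fun hi => ?_⟩⟩
  exact connectedComponentIn_subset _ _ (interior_subset hi) (Or.inl (mem_range_self v))

/-! ### Adjacency in the difference graph and copies of `K_{2,3}` -/

theorem fullDifferenceGraph_adj {G : Type*} [Group G] {x y : G} :
    (fullDifferenceGraph G).Adj x y ↔
      (∃ c : G, x ∈ Subgroup.zpowers c ∧ y ∈ Subgroup.zpowers c) ∧
        x ∉ Subgroup.zpowers y ∧ y ∉ Subgroup.zpowers x := by
  constructor
  · rintro ⟨⟨hne, hc⟩, hp⟩
    refine ⟨hc, fun h => hp ⟨hne, Or.inl h⟩, fun h => hp ⟨hne, Or.inr h⟩⟩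
  · rintro ⟨hc, h1, h2⟩
    refine ⟨⟨?_, hc⟩, fun hp => hp.2.elim h1 h2⟩
    rintro rfl
    exact h1 (Subgroup.mem_zpowers x)

/-- Adjacency depends only on the cyclic subgroups generated; one neighbour therefore yields all
generators of its subgroup as neighbours. -/
theorem fullDifferenceGraph_adj_congr_right {G : Type*} [Group G] {x y y' : G}
    (h : Subgroup.zpowers y = Subgroup.zpowers y') (ha : (fullDifferenceGraph G).Adj x y) :
    (fullDifferenceGraph G).Adj x y' := by
  rw [fullDifferenceGraph_adj] at ha ⊢
  obtain ⟨⟨c, hx, hy⟩, h1, h2⟩ := ha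
  refine ⟨⟨c, hx, ?_⟩, h ▸ h1, fun hy' => h2 ?_⟩
  · rw [← Subgroup.zpowers_le] at hy ⊢
    rwa [← h]
  · rw [← Subgroup.zpowers_le] at hy' ⊢
    rwa [h]

theorem Commute.mem_zpowers_mul_of_coprime {G : Type*} [Group G] {x y : G} (h : Commute x y)
    (hco : (orderOf x).Coprime (orderOf y)) :
    x ∈ Subgroup.zpowers (x * y) ∧ y ∈ Subgroup.zpowers (x * y) := by
  have key : ∀ x y : G, Commute x y → (orderOf x).Coprime (orderOf y) →
      x ∈ Subgroup.zpowers (x * y) := by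
    intro x y h hco
    -- The exponent `orderOf y * m` kills `y` and is 1 modulo `orderOf x`.
    obtain ⟨m, hm⟩ := exists_pow_eq_self_of_coprime hco.symm
    have : x = (x * y) ^ (orderOf y * m) := by
      rw [pow_mul, h.mul_pow, pow_orderOf_eq_one, mul_one, hm]
    have hmem := Subgroup.npow_mem_zpowers (x * y) (orderOf y * m)
    rwa [← this] at hmem
  refine ⟨key x y h hco, ?_⟩
  rw [h.eq]
  exact key y x h.symm hco.symm

theorem notMem_zpowers_of_coprime {G : Type*} [Group G] {x y : G}
    (hco : (orderOf x).Coprime (orderOf y)) (hx : x ≠ 1) : x ∉ Subgroup.zpowers y := by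
  intro h
  exact hx (orderOf_eq_one_iff.1 (hco.eq_one_of_dvd (orderOf_dvd_of_mem_zpowers h)))

theorem fullDifferenceGraph_adj_of_coprime {G : Type*} [Group G] {x y : G} (h : Commute x y)
    (hco : (orderOf x).Coprime (orderOf y)) (hx : x ≠ 1) (hy : y ≠ 1) :
    (fullDifferenceGraph G).Adj x y :=
  fullDifferenceGraph_adj.2 ⟨⟨x * y, h.mem_zpowers_mul_of_coprime hco⟩,
    notMem_zpowers_of_coprime hco hx, notMem_zpowers_of_coprime hco.symm hy⟩

theorem not_isOuterplanar_differenceGraph_of_adj {G : Type*} [Group G] [Finite G] {a b : G}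
    {m : Fin 3 → G} (hab : a ≠ b) (hm : Function.Injective m)
    (ha : ∀ i, (fullDifferenceGraph G).Adj a (m i))
    (hb : ∀ i, (fullDifferenceGraph G).Adj b (m i)) : ¬ IsOuterplanar (differenceGraph G) :=
  not_isOuterplanar_of_adj (Γ := differenceGraph G) (a := ⟨a, m 0, ha 0⟩) (b := ⟨b, m 0, hb 0⟩)
    (m := fun i => ⟨m i, a, (ha i).symm⟩) (fun h => hab (congrArg Subtype.val h))
    (fun _ _ h => hm (congrArg Subtype.val h)) ha hb

theorem exists_injective_ne {α : Type*} [Finite α] (a : α) {n : ℕ} (h : n + 1 ≤ Nat.card α) :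
    ∃ m : Fin n → α, Function.Injective m ∧ ∀ i, m i ≠ a := by
  classical
  have := Fintype.ofFinite α
  have hc : Fintype.card (Fin n) ≤ Fintype.card {x // x ≠ a} := by
    rw [Nat.card_eq_fintype_card] at h
    have := Set.card_ne_eq a
    rw [Fintype.card_fin]
    change n ≤ Fintype.card ({x | x ≠ a} : Set α)
    omega
  obtain ⟨f⟩ := Function.Embedding.nonempty_of_card_le hc
  exact ⟨fun i => f i, Subtype.val_injective.comp f.injective, fun i => (f i).2⟩

/-- Two nontrivial elements of `A` and three of `B` form a `K_{2,3}`. -/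
theorem not_isOuterplanar_differenceGraph_of_subgroups {G : Type*} [Group G] [Finite G]
    {A B : Subgroup G} (hcomm : ∀ x ∈ A, ∀ y ∈ B, Commute x y)
    (hco : (Nat.card A).Coprime (Nat.card B)) (hA : 3 ≤ Nat.card A) (hB : 4 ≤ Nat.card B) :
    ¬ IsOuterplanar (differenceGraph G) := by
  obtain ⟨a, ha, ha1⟩ := exists_injective_ne (1 : A) (n := 2) hA
  obtain ⟨m, hm, hm1⟩ := exists_injective_ne (1 : B) (n := 3) hB
  have hadj : ∀ i j, (fullDifferenceGraph G).Adj (a i : G) (m j : G) := fun i j =>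
    fullDifferenceGraph_adj_of_coprime (hcomm _ (a i).2 _ (m j).2)
      (hco.of_dvd (Subgroup.orderOf_dvd_natCard _ (a i).2)
        (Subgroup.orderOf_dvd_natCard _ (m j).2))
      (fun h => ha1 i (Subtype.ext h)) (fun h => hm1 j (Subtype.ext h))
  exact not_isOuterplanar_differenceGraph_of_adj (a := (a 0 : G)) (b := (a 1 : G))
    (m := fun j => (m j : G)) (fun h => absurd (ha (Subtype.ext h)) (by decide))
    (Subtype.val_injective.comp hm) (hadj 0) (hadj 1)

/-- An element of order `q ^ k` with `q` odd and `k ≥ 2` that commutes with an involution spoils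
outerplanarity. -/
theorem not_isOuterplanar_differenceGraph_of_pow_ne_one {G : Type*} [Group G] [Finite G]
    {q k : ℕ} (hq : q.Prime) (hq2 : 2 < q) {y z : G} (hz : orderOf z = 2) (hzy : Commute z y)
    (hy : orderOf y = q ^ k) (hyq : y ^ q ≠ 1) : ¬ IsOuterplanar (differenceGraph G) := by
  have hy1 : y ≠ 1 := by
    rintro rfl
    simp at hyq
  have hqy : q ∣ orderOf y := by
    rw [hy]
    refine dvd_pow_self q ?_
    rintro rfl
    exact hy1 (orderOf_eq_one_iff.1 (by simpa using hy))
  have h2q : Nat.Coprime 2 q := (Nat.coprime_primes Nat.prime_two hq).2 hq2.ne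
  have hco : (orderOf z).Coprime (orderOf y) := by
    rw [hz, hy]
    exact h2q.pow_right k
  have hz1 : z ≠ 1 := fun h => by simp [h] at hz
  have hmem := hzy.mem_zpowers_mul_of_coprime hco
  have hne : y ^ 2 ≠ 1 := fun h =>
    absurd (Nat.le_of_dvd two_pos (hqy.trans (orderOf_dvd_of_pow_eq_one h))) (by omega)
  -- This is what separates `y⁻¹` from `y ^ 2`; for `q = 3` it is the hypothesis `y ^ q ≠ 1`.
  have hne' : y ^ 3 ≠ 1 := by
    intro h
    have h3 := Nat.le_of_dvd three_pos (hqy.trans (orderOf_dvd_of_pow_eq_one h))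
    obtain rfl : q = 3 := by omega
    exact hyq h
  have hz_y : (fullDifferenceGraph G).Adj z y :=
    fullDifferenceGraph_adj_of_coprime hzy hco hz1 hy1
  have hzq_y : (fullDifferenceGraph G).Adj (z * y ^ q) y := by
    refine fullDifferenceGraph_adj.2 ⟨⟨z * y, mul_mem hmem.1 (pow_mem hmem.2 q), hmem.2⟩, ?_, ?_⟩
    · intro h
      refine notMem_zpowers_of_coprime hco hz1 ?_
      have := mul_mem h (inv_mem (pow_mem (Subgroup.mem_zpowers y) q))
      rwa [mul_inv_cancel_right] at this
    -- Squaring eliminates `z`, so `y ^ 2` would be a power of `y ^ q`. As `q` divides the order of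
    -- `y`, this gives `q ∣ 2`.
    · rintro ⟨n, hn⟩
      have hn : (z * y ^ q) ^ n = y := hn
      have hz2 : z ^ (2 : ℤ) = 1 := by
        have := pow_orderOf_eq_one z
        rw [hz] at this
        exact_mod_cast this
      have h2 : y ^ (2 : ℤ) = y ^ ((q : ℤ) * n * 2) := by
        calc y ^ (2 : ℤ) = ((z * y ^ q) ^ n) ^ (2 : ℤ) := by rw [hn]
          _ = (z ^ (2 : ℤ)) ^ n * y ^ ((q : ℤ) * n * 2) := by
            rw [(hzy.pow_right q).mul_zpow, ((hzy.pow_right q).zpow_zpow n n).mul_zpow,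
              ← zpow_mul, mul_comm n, zpow_mul, ← zpow_natCast y q, ← zpow_mul, ← zpow_mul, ← zpow_mul, mul_assoc]
          _ = _ := by rw [hz2, one_zpow, one_mul]
      have h3 : y ^ (2 - (q : ℤ) * n * 2) = 1 := by rw [zpow_sub, ← h2, mul_inv_cancel]
      have h4 : (q : ℤ) ∣ 2 - (q : ℤ) * n * 2 :=
        (Int.natCast_dvd_natCast.2 hqy).trans (orderOf_dvd_iff_zpow_eq_one.2 h3)
      have h5 : (q : ℤ) ∣ 2 := by
        have := dvd_add h4 (Dvd.intro (n * 2) rfl : (q : ℤ) ∣ q * (n * 2))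
        rwa [show (2 : ℤ) - q * n * 2 + q * (n * 2) = 2 by ring] at this
      have := Int.le_of_dvd two_pos h5
      omega
  have hgen : ∀ i, Subgroup.zpowers y = Subgroup.zpowers ((![y, y⁻¹, y ^ 2] : Fin 3 → G) i) := by
    have h2 : Subgroup.zpowers y = Subgroup.zpowers (y ^ 2) := by
      refine le_antisymm ?_ ?_
      · obtain ⟨m, hm⟩ := exists_pow_eq_self_of_coprime (n := 2) (hz ▸ hco)
        rw [Subgroup.zpowers_le]
        exact ⟨m, by simpa using hm⟩
      · rw [Subgroup.zpowers_le]
        exact Subgroup.npow_mem_zpowers y 2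
    intro i
    fin_cases i
    exacts [rfl, Subgroup.zpowers_inv.symm, h2]
  refine not_isOuterplanar_differenceGraph_of_adj (a := z) (b := z * y ^ q)
    (m := ![y, y⁻¹, y ^ 2]) ?_ ?_ (fun i => fullDifferenceGraph_adj_congr_right (hgen i) hz_y)
    (fun i => fullDifferenceGraph_adj_congr_right (hgen i) hzq_y)
  · simpa using hyq
  · have n1 : y ≠ y⁻¹ := fun h => hne (by rw [pow_two]; exact mul_eq_one_iff_eq_inv.2 h)
    have n2 : y ≠ y ^ 2 := fun h => hy1 (by simpa [pow_two] using h)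
    have n3 : y⁻¹ ≠ y ^ 2 := fun h => hne' (by rw [pow_succ, ← h, inv_mul_cancel])
    intro i j hij
    fin_cases i <;> fin_cases j <;> simp_all

/-! ### Structure of nilpotent groups with outerplanar difference graph -/

theorem exists_two_primes_dvd_card {G : Type*} [Group G] [Finite G]
    (hG : ∀ p : ℕ, p.Prime → ¬ IsPGroup p G) :
    ∃ p q : ℕ, p.Prime ∧ q.Prime ∧ p < q ∧ p ∣ Nat.card G ∧ q ∣ Nat.card G := by
  have key : ∀ p : ℕ, p.Prime → ∃ q : ℕ, q.Prime ∧ q ≠ p ∧ q ∣ Nat.card G := by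
    intro p hp
    by_contra! h
    refine hG p hp (IsPGroup.of_card (Nat.eq_prime_pow_of_unique_prime_dvd Nat.card_pos.ne' ?_))
    intro d hd hdvd
    by_contra hne
    exact h d hd hne hdvd
  -- The argument 2 is arbitrary: it only serves to produce some prime divisor.
  obtain ⟨p, hp, -, hpd⟩ := key 2 Nat.prime_two
  obtain ⟨q, hq, hqp, hqd⟩ := key p hp
  rcases lt_or_gt_of_ne hqp with h | h
  · exact ⟨q, p, hq, hp, h, hqd, hpd⟩
  · exact ⟨p, q, hp, hq, h, hpd, hqd⟩

section

variable {G : Type*} [Group G] [Finite G] [Group.IsNilpotent G]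

theorem Sylow.commute_of_isNilpotent {p q : ℕ} [hp : Fact p.Prime] [hq : Fact q.Prime]
    (hpq : p ≠ q) (P : Sylow p G) (Q : Sylow q G) : ∀ x ∈ (P : Subgroup G), ∀ y ∈ (Q : Subgroup G),
      Commute x y := fun x hx y hy =>
  Subgroup.commute_of_normal_of_disjoint _ _ inferInstance inferInstance
    (IsPGroup.disjoint_of_ne p q hpq _ _ P.isPGroup' Q.isPGroup') x y hx hy

theorem Sylow.card_eq_two_of_isOuterplanar (ho : IsOuterplanar (differenceGraph G)) {p q : ℕ}
    [hp : Fact p.Prime] [hq : Fact q.Prime] (hpq : p < q) (hpd : p ∣ Nat.card G)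
    (hqd : q ∣ Nat.card G) (P : Sylow p G) : p = 2 ∧ Nat.card P = 2 := by
  let Q : Sylow q G := default
  have hcomm := Sylow.commute_of_isNilpotent hpq.ne P Q
  have hco : (Nat.card P).Coprime (Nat.card Q) :=
    IsPGroup.coprime_card_of_ne p q hpq.ne _ _ P.isPGroup' Q.isPGroup'
  have hpP : p ∣ Nat.card P := P.dvd_card_of_dvd_card hpd
  have hqQ : q ∣ Nat.card Q := Q.dvd_card_of_dvd_card hqd
  have h2 := hp.out.two_le
  have hp_le := Nat.le_of_dvd Nat.card_pos hpP
  have hq_le := Nat.le_of_dvd Nat.card_pos hqQ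
  have hP : Nat.card P ≤ 2 := by
    by_contra! h3
    -- Since `q ≥ 3`, a group `P` of order at least 4 can serve as the larger side. If `P` has order
    -- 3, then `q > 3` and `Q` is the larger side.
    rcases Nat.lt_or_ge 3 (Nat.card P) with h4 | h4
    · exact not_isOuterplanar_differenceGraph_of_subgroups
        (fun x hx y hy => (hcomm y hy x hx).symm) hco.symm (by omega) h4 ho
    · have hP3 : Nat.card P = 3 := by omega
      have hp3 : p = 3 := (Nat.prime_dvd_prime_iff_eq hp.out Nat.prime_three).1 (hP3 ▸ hpP)
      exact not_isOuterplanar_differenceGraph_of_subgroups hcomm hco h3 (by omega) ho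
  omega

end

theorem nonempty_mulEquiv_zmod_two_prod {G : Type*} [Group G] {A B : Subgroup G}
    (hcomm : ∀ x ∈ A, ∀ y ∈ B, Commute x y) (hA : Nat.card A = 2) (hd : Disjoint A B)
    (hsup : A ⊔ B = ⊤) : Nonempty (G ≃* Multiplicative (ZMod 2) × B) := by
  have : Fact (Nat.Prime 2) := ⟨Nat.prime_two⟩
  let eA : A ≃* Multiplicative (ZMod 2) := mulEquivOfPrimeCardEq (p := 2) hA (by simp)
  let f := MonoidHom.noncommCoprod A.subtype B.subtype fun m n => hcomm m m.2 n n.2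
  have hf : Function.Bijective f := by
    constructor
    · refine (MonoidHom.noncommCoprod_injective _ _ _).2
        ⟨A.subtype_injective, B.subtype_injective, ?_⟩
      simpa using hd
    · rw [← MonoidHom.range_eq_top]
      refine (MonoidHom.noncommCoprod_range _ _ _).trans ?_
      simpa using hsup
  exact ⟨(MulEquiv.ofBijective f hf).symm.trans (eA.prodCongr (MulEquiv.refl B))⟩

theorem isZTwoProdExponentPrime_of_isOuterplanar {G : Type u} [Group G] [Finite G]
    [Group.IsNilpotent G] (hG : ∀ p : ℕ, p.Prime → ¬ IsPGroup p G)
    (ho : IsOuterplanar (differenceGraph G)) : IsZTwoProdExponentPrime G := by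
  obtain ⟨p, q, hp, hq, hpq, hpd, hqd⟩ := exists_two_primes_dvd_card hG
  have := Fact.mk hp
  have := Fact.mk hq
  let P : Sylow p G := default
  let Q : Sylow q G := default
  obtain ⟨rfl, hP⟩ := Sylow.card_eq_two_of_isOuterplanar ho hpq hpd hqd P
  have hcomm := Sylow.commute_of_isNilpotent hpq.ne P Q
  have hsup : (P : Subgroup G) ⊔ Q = ⊤ := by
    rw [← Subgroup.index_eq_one]
    by_contra h1
    obtain ⟨r, hr, hrd⟩ := Nat.exists_prime_and_dvd h1
    have := Fact.mk hr
    have hrG : r ∣ Nat.card G := hrd.trans (Subgroup.index_dvd_card _)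
    have hr2 : r ≠ 2 := by
      rintro rfl
      exact P.not_dvd_index (hrd.trans (Subgroup.index_dvd_of_le le_sup_left))
    -- Of `r` and `q`, the smaller must be 2, but both are odd; and `r = q` cannot divide the index
    -- of the Sylow subgroup `Q`.
    rcases lt_trichotomy r q with h | rfl | h
    · exact hr2 (Sylow.card_eq_two_of_isOuterplanar ho h hrG hqd default).1
    · exact Q.not_dvd_index (hrd.trans (Subgroup.index_dvd_of_le le_sup_right))
    · exact hpq.ne' (Sylow.card_eq_two_of_isOuterplanar ho h hqd hrG default).1
  have hd : Disjoint (P : Subgroup G) Q :=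
    IsPGroup.disjoint_of_ne 2 q hpq.ne _ _ P.isPGroup' Q.isPGroup'
  refine ⟨q, hq, hpq, Q, inferInstance, Q.isPGroup', ?_,
    nonempty_mulEquiv_zmod_two_prod hcomm hP hd hsup⟩
  obtain ⟨z, hz, hz1⟩ := exists_injective_ne (1 : P) (n := 1) hP.ge
  have hz2 : orderOf (z 0 : G) = 2 := by
    refine orderOf_eq_prime ?_ (fun h => hz1 0 (Subtype.ext h))
    have h1 : z 0 ^ Nat.card (P : Subgroup G) = 1 := pow_card_eq_one'
    rw [hP] at h1
    exact congrArg Subtype.val h1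
  have hpow : ∀ y : Q, y ^ q = 1 := by
    intro y
    by_contra hy
    obtain ⟨k, hk⟩ := IsPGroup.iff_orderOf.1 Q.isPGroup' y
    refine not_isOuterplanar_differenceGraph_of_pow_ne_one hq hpq hz2
      (hcomm _ (z 0).2 _ y.2) (k := k) ?_ (fun h => hy (Subtype.ext h)) ho
    rw [Subgroup.orderOf_coe, hk]
  refine ((Nat.dvd_prime hq).1 (Monoid.exponent_dvd_of_forall_pow_eq_one hpow)).resolve_left ?_
  intro h1
  have := Monoid.exp_eq_one_iff.1 h1
  have hQ : Nat.card Q = 1 := Nat.card_of_subsingleton 1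
  have := Q.dvd_card_of_dvd_card hqd
  rw [hQ] at this
  exact hq.one_lt.ne' (Nat.dvd_one.1 this)

/-! ### The converse: the difference graph is a star -/

theorem isStarGraph_induce_support {V : Type*} {Γ : SimpleGraph V} {z : V} {S : Set V}
    (hfin : S.Finite) (hne : S.Nonempty) (hz : z ∉ S)
    (h : ∀ x y, Γ.Adj x y ↔ (x = z ∧ y ∈ S) ∨ (y = z ∧ x ∈ S)) :
    IsStarGraph (Γ.induce Γ.support) := by
  have := hfin.to_subtype
  obtain ⟨n, ⟨e⟩⟩ := Finite.exists_equiv_fin S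
  obtain ⟨s, hs⟩ := hne
  have hzs : z ∈ Γ.support := ⟨s, (h z s).2 (Or.inl ⟨rfl, hs⟩)⟩
  have hS : ∀ s ∈ S, s ∈ Γ.support := fun s hs => ⟨z, (h s z).2 (Or.inr ⟨rfl, hs⟩)⟩
  let f : Fin 1 ⊕ Fin n → Γ.support :=
    Sum.elim (fun _ => ⟨z, hzs⟩) fun k => ⟨e.symm k, hS _ (e.symm k).2⟩
  have hzk : ∀ k, z ≠ e.symm k := fun k hk => hz (hk ▸ (e.symm k).2)
  have hf : Function.Bijective f := by
    constructor
    · rintro (i | k) (j | l) hij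
      · rw [Subsingleton.elim i j]
      · exact absurd (congrArg Subtype.val hij) (hzk l)
      · exact absurd (congrArg Subtype.val hij).symm (hzk k)
      · have hkl : (e.symm k : V) = e.symm l := congrArg (Subtype.val : Γ.support → V) hij
        rw [e.symm.injective (Subtype.ext hkl)]
    · rintro ⟨x, y, hxy⟩
      rcases (h x y).1 hxy with ⟨rfl, -⟩ | ⟨-, hx⟩
      · exact ⟨.inl 0, rfl⟩
      · exact ⟨.inr (e ⟨x, hx⟩), Subtype.ext
          (congrArg (Subtype.val : S → V) (e.symm_apply_apply ⟨x, hx⟩))⟩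
  refine ⟨n, (e ⟨s, hs⟩).pos, ⟨RelIso.symm ⟨Equiv.ofBijective f hf, ?_⟩⟩⟩
  rintro (i | k) (j | l)
  · change Γ.Adj z z ↔ _
    simp
  · change Γ.Adj z (e.symm l) ↔ _
    simp [h]
  · change Γ.Adj (e.symm k) z ↔ _
    simp [h]
  · change Γ.Adj (e.symm k) (e.symm l) ↔ _
    simp [h, (hzk k).symm, (hzk l).symm]

/-- The difference graph of a group generated by a central involution and elements of odd prime
order `p`. -/
theorem fullDifferenceGraph_adj_iff {G : Type*} [Group G] {p : ℕ} (hp : p.Prime) (hp2 : 2 < p)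
    {z : G} (hz : orderOf z = 2) (hcomm : ∀ g, Commute z g)
    (hpow : ∀ g : G, ∃ h : G, h ^ p = 1 ∧ (g = h ∨ g = z * h)) (x y : G) :
    (fullDifferenceGraph G).Adj x y ↔
      (x = z ∧ y ∈ {y : G | y ^ p = 1 ∧ y ≠ 1}) ∨ (y = z ∧ x ∈ {y : G | y ^ p = 1 ∧ y ≠ 1}) := by
  have hz1 : z ≠ 1 := fun h => by simp [h] at hz
  have hco : ∀ h : G, h ^ p = 1 → (orderOf z).Coprime (orderOf h) := fun h hh =>
    hz ▸ ((Nat.coprime_primes Nat.prime_two hp).2 hp2.ne).of_dvd_right (orderOf_dvd_of_pow_eq_one hh)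
  have hstar : ∀ y : G, y ^ p = 1 → y ≠ 1 → (fullDifferenceGraph G).Adj z y := fun y hy hy1 =>
    fullDifferenceGraph_adj_of_coprime (hcomm y) (hco y hy) hz1 hy1
  have hzpow : ∀ n : ℤ, z ^ n = 1 ∨ z ^ n = z := by
    have hz2 : z ^ (2 : ℤ) = 1 := by
      have := pow_orderOf_eq_one z
      rw [hz] at this
      exact_mod_cast this
    intro n
    rcases Int.even_or_odd' n with ⟨m, rfl | rfl⟩
    · exact Or.inl (by rw [zpow_mul, hz2, one_zpow])
    · exact Or.inr (by rw [zpow_add_one, zpow_mul, hz2, one_zpow, one_mul])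
  have hform : ∀ h : G, ∀ c : G, c = h ∨ c = z * h → ∀ x ∈ Subgroup.zpowers c,
      ∃ n : ℤ, x = h ^ n ∨ x = z * h ^ n := by
    rintro h c hc x ⟨n, rfl⟩
    refine ⟨n, ?_⟩
    rcases hc with rfl | rfl
    · exact Or.inl rfl
    · change (z * h) ^ n = _ ∨ (z * h) ^ n = _
      rw [(hcomm h).mul_zpow]
      rcases hzpow n with h1 | h1 <;> simp [h1]
  -- As `p` is prime, an exponent with `h ^ n ≠ 1` is invertible modulo `p`, by Bézout.
  have hgen : ∀ h : G, h ^ p = 1 → ∀ n : ℤ, h ^ n ≠ 1 → h ∈ Subgroup.zpowers (h ^ n) := by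
    intro h hh n hn
    have hcop : IsCoprime n (p : ℤ) := by
      refine (((Nat.prime_iff_prime_int.1 hp).coprime_iff_not_dvd).2 ?_).symm
      rintro ⟨m, rfl⟩
      exact hn (by rw [zpow_mul, zpow_natCast, hh, one_zpow])
    obtain ⟨a, b, hab⟩ := hcop
    refine ⟨a, ?_⟩
    change (h ^ n) ^ a = h
    calc (h ^ n) ^ a = h ^ (a * n) * ((h ^ p) ^ b) := by
          rw [hh, one_zpow, mul_one, ← zpow_mul, mul_comm]
      _ = h ^ (a * n + b * p) := by
          rw [zpow_add, ← zpow_natCast, ← zpow_mul, mul_comm b]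
      _ = h := by rw [hab, zpow_one]
  have hpz : ∀ h : G, h ^ p = 1 → ∀ n : ℤ, (h ^ n) ^ p = 1 := fun h hh n => by
    rw [← zpow_natCast, zpow_comm, zpow_natCast, hh, one_zpow]
  constructor
  · rw [fullDifferenceGraph_adj]
    rintro ⟨⟨c, hx, hy⟩, hxy, hyx⟩
    obtain ⟨h, hh, hc⟩ := hpow c
    obtain ⟨n, hn⟩ := hform h c hc x hx
    obtain ⟨m, hm⟩ := hform h c hc y hy
    -- An end with trivial `h`-part is 1 or `z`, and 1 is a power of everything. The other end
    -- cannot involve `z`, since `z` would then be one of its powers.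
    have hzero : ∀ x y : G, ∀ n m : ℤ, x ∉ Subgroup.zpowers y → y ∉ Subgroup.zpowers x →
        (x = h ^ n ∨ x = z * h ^ n) → (y = h ^ m ∨ y = z * h ^ m) → h ^ n = 1 →
        x = z ∧ y ^ p = 1 ∧ y ≠ 1 := by
      intro x y n m hxy hyx hn hm h1
      rw [h1, mul_one] at hn
      have hx1 : x = z := hn.resolve_left (fun h => hxy (h ▸ one_mem _))
      have hy1 : y ≠ 1 := fun h => hyx (h ▸ one_mem _)
      refine ⟨hx1, ?_, hy1⟩
      rcases hm with rfl | rfl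
      · exact hpz h hh m
      · refine absurd ?_ hxy
        rw [hx1]
        exact ((hcomm _).mem_zpowers_mul_of_coprime (hco _ (hpz h hh m))).1
    -- If both parts of `x` are nontrivial, its powers include `z` and `h`, hence `y`.
    have hfull : ∀ x y : G, ∀ n m : ℤ, h ^ n ≠ 1 → x = z * h ^ n →
        (y = h ^ m ∨ y = z * h ^ m) → y ∈ Subgroup.zpowers x := by
      rintro x y n m hn rfl hm
      have hmem := (hcomm _).mem_zpowers_mul_of_coprime (hco _ (hpz h hh n))
      have hhm : h ∈ Subgroup.zpowers (z * h ^ n) :=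
        Subgroup.zpowers_le.2 hmem.2 (hgen h hh n hn)
      rcases hm with rfl | rfl
      · exact zpow_mem hhm m
      · exact mul_mem hmem.1 (zpow_mem hhm m)
    by_cases hn1 : h ^ n = 1
    · exact Or.inl (hzero x y n m hxy hyx hn hm hn1)
    by_cases hm1 : h ^ m = 1
    · exact Or.inr (hzero y x m n hyx hxy hm hn hm1)
    exfalso
    rcases hn with hxn | hxn
    · rcases hm with hym | hym
      · refine hyx ?_
        rw [hym, hxn]
        exact zpow_mem (hgen h hh n hn1) m
      · exact hxy (hfull y x m n hm1 hym (Or.inl hxn))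
    · exact hyx (hfull x y n m hn1 hxn hm)
  · rintro (⟨rfl, hy, hy1⟩ | ⟨rfl, hx, hx1⟩)
    · exact hstar y hy hy1
    · exact (hstar x hx hx1).symm

theorem IsZTwoProdExponentPrime.isStarGraph {G : Type u} [Group G] [Finite G]
    (h : IsZTwoProdExponentPrime G) : IsStarGraph (differenceGraph G) := by
  obtain ⟨p, hp, hp2, P, _, -, hexp, ⟨e⟩⟩ := h
  have hP : ∀ a : P, a ^ p = 1 := fun a => hexp ▸ Monoid.pow_exponent_eq_one a
  let z : G := e.symm (Multiplicative.ofAdd 1, 1)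
  have hz2 : ∀ a : Multiplicative (ZMod 2), a = 1 ∨ a = Multiplicative.ofAdd 1 := by decide
  have hsq : (Multiplicative.ofAdd 1 : Multiplicative (ZMod 2)) ^ 2 = 1 := by decide
  have hne : (Multiplicative.ofAdd 1 : Multiplicative (ZMod 2)) ≠ 1 := by decide
  have hz : orderOf z = 2 := by
    refine orderOf_eq_prime ?_ ?_
    · rw [← map_pow, Prod.pow_mk, one_pow]
      exact (map_eq_one_iff _ e.symm.injective).2 (Prod.ext hsq rfl)
    · rw [Ne, map_eq_one_iff _ e.symm.injective]
      exact fun h => hne (congrArg Prod.fst h)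
  have hcomm : ∀ g, Commute z g := by
    intro g
    obtain ⟨⟨a, b⟩, rfl⟩ := e.symm.surjective g
    exact Commute.map (Prod.ext (mul_comm _ _) (by simp)) e.symm
  have hpow : ∀ g : G, ∃ h : G, h ^ p = 1 ∧ (g = h ∨ g = z * h) := by
    intro g
    obtain ⟨⟨a, b⟩, rfl⟩ := e.symm.surjective g
    refine ⟨e.symm (1, b), ?_, ?_⟩
    · rw [← map_pow, Prod.pow_mk, one_pow, hP]
      exact map_one _
    · rcases hz2 a with rfl | rfl
      · exact Or.inl rfl
      · refine Or.inr ?_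
        rw [← map_mul, Prod.mk_mul_mk, mul_one, one_mul]
  refine isStarGraph_induce_support (z := z) (S := {y : G | y ^ p = 1 ∧ y ≠ 1}) (Set.toFinite _)
    ?_ ?_ (fullDifferenceGraph_adj_iff hp hp2 hz hcomm hpow)
  · have : Nontrivial P := by
      rw [← not_subsingleton_iff_nontrivial, ← Monoid.exp_eq_one_iff, hexp]
      exact hp.one_lt.ne'
    obtain ⟨b, hb⟩ := exists_ne (1 : P)
    refine ⟨e.symm (1, b), ?_, ?_⟩
    · rw [← map_pow, Prod.pow_mk, one_pow, hP]
      exact map_one _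
    · rw [Ne, map_eq_one_iff _ e.symm.injective]
      exact fun h => hb (congrArg Prod.snd h)
  · rintro ⟨h, -⟩
    have hdvd := orderOf_dvd_of_pow_eq_one h
    rw [hz] at hdvd
    have := (Nat.prime_dvd_prime_iff_eq Nat.prime_two hp).1 hdvd
    omega

theorem mainTheorem9 (G : Type u) [Group G] [Finite G] [Group.IsNilpotent G]
    (hG : ∀ p : ℕ, p.Prime → ¬ IsPGroup p G) :
    (IsOuterplanar (differenceGraph G) ↔ IsZTwoProdExponentPrime G) ∧
      (IsZTwoProdExponentPrime G → IsStarGraph (differenceGraph G)) :=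
  ⟨⟨isZTwoProdExponentPrime_of_isOuterplanar hG, fun h => h.isStarGraph.isOuterplanar⟩,
    fun h => h.isStarGraph⟩
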